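/- Let $T$ be a tree (a connected graph without cycles) in which every vertex has finitely many neighbours, with a root vertex $o$ that has exactly one neighbour; the edge at $o$ is the root edge $\omega$. Write $E(T)$ for the set of edges. The edges are ordered by $\alpha\le\beta$ if $\alpha$ lies on the geodesic from $o$ through $\beta$; the level $|\alpha|$ is the number of edges strictly preceding $\alpha$ (so $|\omega|=0$), and $\deg(\alpha)$ is the number of edges departing, away from the root, from the end vertex of $\alpha$. The boundary $\partial T$ consists of the infinite geodesics starting at $o$, together with the leaves (the edges that are maximal for $\le$), if there are any. For $\zeta\in\partial T$ let $P(\zeta)$ be the set of edges of the geodesic from $o$ to $\zeta$ (the final edge included if $\zeta$ is a leaf), and let $\partial T_\alpha=\{\zeta\in\partial T:\alpha\in P(\zeta)\}$. The sets $\partial T_\alpha$, $\alpha\in E(T)$, form a basis of the topology of $\partial T$. Let $1<p<\infty$ and $1/p+1/p'=1$. For $E\subseteq\partial T$ let $\Omega_E$ be the set of nonnegative $f\in\ell^p(E(T))$ with $\sum_{\alpha\in P(\zeta)}f(\alpha)\ge 1$ for all $\zeta\in E$, and let $c_p(E)=\inf_{f\in\Omega_E}\|f\|_p^p$. A $p$-equilibrium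 measure of $E$ is a finite positive Borel measure $\mu$ on $\partial T$, carried by $\overline E$, with $\mu(\overline E)=c_p(E)$ and such that, with $M(\alpha)=\mu(\partial T_\alpha)$ the co-potential of $\mu$, the function $M^{p'-1}$ lies in the $\ell^p$-closure of $\Omega_E$ and $\|M^{p'-1}\|_p^p=c_p(E)$. (a) Suppose that $T$ is spherically symmetric, i.e. $\deg(\alpha)$ depends only on $|\alpha|$. Then $\partial T$ has exactly one $p$-equilibrium measure, and this measure is spherically symmetric: its co-potential $M(\alpha)$ depends only on $|\alpha|$. Moreover, with $N_k$ the number of edges of level $k$, $$c_p(\partial T)=\Big(\sum_{k:\,N_k\neq 0}N_k^{1-p'}\Big)^{1-p},$$ where the right-hand side is $0$ if the series diverges. (b) If $n\ge 1$ is an integer and $T$ is homogeneous of order $n$, i.e. $\deg(\alpha)=n$ for every edge $\alpha$, then $c_p(\partial T)=\big(1-n^{1-p'}\big)^{p-1}$. -/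

import Mathlib

open MeasureTheory
open scoped ENNReal

noncomputable section

/-- A locally finite tree with a distinguished root vertex, the root being adjacent to exactly one
other vertex (through the root edge). -/
structure RootEdgeTree (V : Type*) where
  graph : SimpleGraph V
  isTree : graph.IsTree
  root : V
  root_adj : ∃! x, graph.Adj root x
  locallyFinite : ∀ x, (graph.neighborSet x).Finite

namespace RootEdgeTree

/-- The edges of `T`. As `T` is a tree, the endpoints of an edge are at distances from the root
which differ by one, so that every edge is listed exactly once, with its beginning vertex `b` and
its ending vertex `e`. -/
@[ext]
structure Edge {V : Type*} (T : RootEdgeTree V) where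
  b : V
  e : V
  adj : T.graph.Adj b e
  dist_eq : T.graph.dist T.root e = T.graph.dist T.root b + 1

variable {V : Type*} (T : RootEdgeTree V)

/-- The level `|α|`: the number of edges strictly preceding `α`. -/
def level (α : T.Edge) : ℕ := T.graph.dist T.root α.b

/-- The degree of an edge: the number of edges departing from its ending vertex. -/
def deg (α : T.Edge) : ℕ := {β : T.Edge | β.b = α.e}.ncard

/-- The number `N_k` of edges at level `k`. -/
def levelCard (k : ℕ) : ℕ := {α : T.Edge | T.level α = k}.ncard

def IsSphericallySymmetric : Prop :=
  ∀ α β : T.Edge, T.level α = T.level β → T.deg α = T.deg β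

/-- Homogeneous trees of order `n`. -/
def IsHomogeneous (n : ℕ) : Prop := ∀ α : T.Edge, T.deg α = n

/-- The predecessor set of a vertex: the edges of the geodesic from the root to `x`. -/
def vertexPred (x : V) : Set T.Edge :=
  {α | ∃ q : T.graph.Walk T.root x, q.IsPath ∧ s(α.b, α.e) ∈ q.edges}

/-- The edge order: `α ≤ β` if `α` lies on the geodesic from the root through `β`. -/
def edgeLE (α β : T.Edge) : Prop := α ∈ T.vertexPred β.e

def IsLeaf (α : T.Edge) : Prop := ∀ β : T.Edge, T.edgeLE α β → β = α

/-- The boundary: the half-infinite geodesics starting from the root, together with the leaves. -/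
inductive Boundary {V : Type*} (T : RootEdgeTree V)
  | ray (x : ℕ → V) (zero : x 0 = T.root) (adj : ∀ n, T.graph.Adj (x n) (x (n + 1)))
      (inj : Function.Injective x) : Boundary T
  | leaf (α : T.Edge) (isLeaf : T.IsLeaf α) : Boundary T

/-- The predecessor set `P(ζ)` of a boundary point. -/
def pred : T.Boundary → Set T.Edge
  | .ray x _ _ _ => {α | ∃ n, α.b = x n ∧ α.e = x (n + 1)}
  | .leaf α _ => T.vertexPred α.e

/-- The boundary `∂T_α` of the tent rooted at `α`, as a subset of `∂T`. -/
def tentBoundary (α : T.Edge) : Set T.Boundary := {ζ | α ∈ T.pred ζ}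

instance : TopologicalSpace T.Boundary :=
  TopologicalSpace.generateFrom (Set.range T.tentBoundary)

instance : MeasurableSpace T.Boundary := borel T.Boundary

instance : BorelSpace T.Boundary := ⟨rfl⟩

/-- The potential `If(ζ) = ∑_{α ∈ P(ζ)} f(α)` (of a nonnegative edge function `f`). -/
def potential (f : T.Edge → ℝ) (ζ : T.Boundary) : ℝ≥0∞ :=
  ∑' α : T.pred ζ, ENNReal.ofReal (f α)

/-- The co-potential `I*μ(α) = μ(∂T_α)`. -/
def copotential (μ : Measure T.Boundary) (α : T.Edge) : ℝ := μ.real (T.tentBoundary α)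

/-- A measure is spherically symmetric if its co-potential is constant on levels. -/
def IsSphericallySymmetricMeasure (μ : Measure T.Boundary) : Prop :=
  ∀ α β : T.Edge, T.level α = T.level β → T.copotential μ α = T.copotential μ β

/-- The space `ℓ^p` of `p`-summable functions on the edges. -/
abbrev EdgeLp (p : ℝ) := lp (fun _ : T.Edge => ℝ) (ENNReal.ofReal p)

instance fact_one_le_ofReal (p : ℝ) [h : Fact (1 < p)] : Fact (1 ≤ ENNReal.ofReal p) :=
  ⟨ENNReal.one_le_ofReal.2 h.out.le⟩

/-- The set `Ω_E` of nonnegative `ℓ^p` functions `f` with `If ≥ 1` on `E`. -/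
def testFunctions (p : ℝ) (E : Set T.Boundary) : Set (T.EdgeLp p) :=
  {f | (∀ α, 0 ≤ f α) ∧ ∀ ζ ∈ E, 1 ≤ T.potential f ζ}

/-- The `p`-capacity of a subset of the boundary. -/
def capacity (p : ℝ) (E : Set T.Boundary) : ℝ≥0∞ :=
  ⨅ f ∈ T.testFunctions p E, ENNReal.ofReal (‖f‖ ^ p)

/-- `f` is a `p`-equilibrium function of `E`: it lies in the `ℓ^p`-closure of `Ω_E` and
`‖f‖_p^p = c_p(E)`. -/
def IsEquilibriumFunction (p : ℝ) [Fact (1 < p)] (E : Set T.Boundary) (f : T.EdgeLp p) : Prop :=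
  f ∈ closure (T.testFunctions p E) ∧ ENNReal.ofReal (‖f‖ ^ p) = T.capacity p E

/-- `μ` is a `p`-equilibrium measure of `E`: a finite positive Borel measure, carried by the
closure of `E`, with total mass `c_p(E)`, such that `M_p = (I*μ)^(p' - 1)` is a `p`-equilibrium
function of `E`. -/
structure IsEquilibriumMeasure (p : ℝ) [Fact (1 < p)] (E : Set T.Boundary)
    (μ : Measure T.Boundary) : Prop where
  finite : IsFiniteMeasure μ
  support : μ (closure E)ᶜ = 0
  mass : μ (closure E) = T.capacity p E
  equilibrium : ∃ f : T.EdgeLp p, (∀ α, f α = T.copotential μ α ^ (p.conjExponent - 1)) ∧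
    T.IsEquilibriumFunction p E f

end RootEdgeTree

end

/-! On a spherically symmetric tree, let a walk descend from the root edge, choosing uniformly among
the children of each edge and resting at leaves. The law σ of its limit satisfies σ(∂T_α) =
1/N_{|α|} (`uniformBoundary_tentBoundary`).

Put S = ∑ N_k^{1-p'}. For an admissible f, integrating its potential against σ gives ∑ f(α)/N_{|α|}
≥ 1 by Tonelli, and Hölder turns this into ‖f‖^p ≥ S^{1-p} (`levelSum_rpow_le`). Equality in Hölder
suggests the radial function S⁻¹ N_{|α|}^{1-p'}. Its truncations to finitely many levels, normalised
by partial sums of S, give the matching upper bound whether or not S converges (`capacity_univ`).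

If S is finite, the measure S^{1-p} σ has this optimal function as its M^{p'-1}, because (1-p)(p'-1)
= -1. If S diverges, the capacity is 0 and the zero measure works. Uniqueness comes from strict
convexity of t^p: the equilibrium function is unique, it determines the co-potential, and the tents
form a generating π-system, so the measure is determined. In the homogeneous case N_k = n^k and S is
a geometric series. -/

noncomputable section

namespace RootEdgeTree

/-! ### Edges, levels and children -/

section Edges

variable {V : Type*} (T : RootEdgeTree V)

/-- Shortest paths to `a` and to `b`, each extended by the edge to `x`, are paths from the root to
`x`; in a tree they coincide, hence so do their penultimate vertices. -/
theorem eq_of_adj_of_dist {a b x : V} (ha : T.graph.Adj a x) (hb : T.graph.Adj b x)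
    (hda : T.graph.dist T.root x = T.graph.dist T.root a + 1)
    (hdb : T.graph.dist T.root x = T.graph.dist T.root b + 1) : a = b := by
  obtain ⟨p, -, hpl⟩ := T.isTree.connected.exists_path_of_dist T.root a
  obtain ⟨q, -, hql⟩ := T.isTree.connected.exists_path_of_dist T.root b
  have h1 : (p.concat ha).IsPath := SimpleGraph.Walk.isPath_of_length_eq_dist _ (by simp; omega)
  have h2 : (q.concat hb).IsPath := SimpleGraph.Walk.isPath_of_length_eq_dist _ (by simp; omega)
  have h := (T.isTree.existsUnique_path T.root x).unique h1 h2
  have := congrArg SimpleGraph.Walk.penultimate h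
  simpa using this

variable {T}

/-- This makes parents unique, so that distinct edges have disjoint sets of children. -/
theorem Edge.eq_of_e_eq {α β : T.Edge} (h : α.e = β.e) : α = β := by
  have hb : α.b = β.b := by
    refine T.eq_of_adj_of_dist (x := α.e) α.adj ?_ α.dist_eq ?_
    · rw [h]; exact β.adj
    · rw [h]; exact β.dist_eq
  exact Edge.ext hb h

theorem dist_e (α : T.Edge) : T.graph.dist T.root α.e = T.level α + 1 := α.dist_eq

theorem level_of_b_eq_e {α β : T.Edge} (h : β.b = α.e) : T.level β = T.level α + 1 := by
  rw [level, h, dist_e]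

theorem exists_edge_of_ne_root {x : V} (hx : x ≠ T.root) : ∃ α : T.Edge, α.e = x := by
  obtain ⟨p, -, hpl⟩ := T.isTree.connected.exists_path_of_dist T.root x
  have hnil : ¬ p.Nil := fun h => hx h.eq.symm
  have hadj := p.adj_penultimate hnil
  refine ⟨⟨p.penultimate, x, hadj, ?_⟩, rfl⟩
  have h1 : T.graph.dist T.root p.penultimate ≤ p.dropLast.length := SimpleGraph.dist_le _
  have h2 : p.dropLast.length + 1 = p.length := SimpleGraph.Walk.length_dropLast_add_one hnil
  rcases T.isTree.dist_eq_dist_add_one_of_adj T.root hadj with h | h <;> omega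

theorem exists_parent {β : T.Edge} {k : ℕ} (h : T.level β = k + 1) :
    ∃ α : T.Edge, β.b = α.e ∧ T.level α = k := by
  have hb : β.b ≠ T.root := by
    intro hb
    rw [level, hb, SimpleGraph.dist_self] at h
    omega
  obtain ⟨α, hα⟩ := exists_edge_of_ne_root hb
  refine ⟨α, hα.symm, ?_⟩
  have := level_of_b_eq_e hα.symm
  omega

theorem b_eq_root {α : T.Edge} (h : T.level α = 0) : α.b = T.root :=
  ((T.isTree.connected.dist_eq_zero_iff).1 h).symm

theorem eq_of_level_eq_zero {α β : T.Edge} (hα : T.level α = 0) (hβ : T.level β = 0) : α = β := by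
  have h1 := b_eq_root hα
  have h2 := b_eq_root hβ
  refine Edge.ext (h1.trans h2.symm) (T.root_adj.unique ?_ ?_)
  · rw [← h1]; exact α.adj
  · rw [← h2]; exact β.adj

variable (T) in
theorem exists_rootEdge : ∃ α : T.Edge, T.level α = 0 := by
  obtain ⟨x, hx, -⟩ := T.root_adj
  exact ⟨⟨T.root, x, hx, by simp [SimpleGraph.dist_eq_one_iff_adj.2 hx]⟩, by simp [level]⟩

variable (T) in
/-- The root edge `ω`. -/
def rootEdge : T.Edge := T.exists_rootEdge.choose

@[simp] theorem level_rootEdge : T.level T.rootEdge = 0 := T.exists_rootEdge.choose_spec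

/-- The edges departing from the end of `α`. -/
def children (α : T.Edge) : Set T.Edge := {β | β.b = α.e}

theorem finite_children (α : T.Edge) : (children α).Finite := by
  refine Set.Finite.of_finite_image (f := Edge.e) ((T.locallyFinite α.e).subset ?_) ?_
  · rintro _ ⟨β, hβ, rfl⟩
    have hb : β.b = α.e := hβ
    have := β.adj
    rw [hb] at this
    exact this
  · intro β _ γ _ h
    exact Edge.eq_of_e_eq h

theorem deg_eq_zero_iff {α : T.Edge} : T.deg α = 0 ↔ children α = ∅ :=
  Set.ncard_eq_zero (finite_children α)

variable (T) in
/-- The edges of level `k`. -/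
def levelSet (k : ℕ) : Set T.Edge := {α | T.level α = k}

theorem levelSet_succ (k : ℕ) : T.levelSet (k + 1) = ⋃ α ∈ T.levelSet k, children α := by
  ext β
  simp only [Set.mem_iUnion, exists_prop]
  constructor
  · intro h
    obtain ⟨α, h1, h2⟩ := exists_parent h
    exact ⟨α, h2, h1⟩
  · rintro ⟨α, h1, h2⟩
    have h1 : T.level α = k := h1
    have := level_of_b_eq_e h2
    show T.level β = _
    omega

theorem finite_levelSet (k : ℕ) : (T.levelSet k).Finite := by
  induction k with
  | zero =>
    refine Set.Subsingleton.finite fun α hα β hβ => eq_of_level_eq_zero hα hβ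
  | succ k ih =>
    rw [levelSet_succ]
    exact ih.biUnion fun α _ => finite_children α

instance : Countable T.Edge := by
  have h : (Set.univ : Set T.Edge) = ⋃ k, T.levelSet k := by
    ext α
    simp [levelSet]
  rw [← Set.countable_univ_iff, h]
  exact Set.countable_iUnion fun k => (finite_levelSet k).countable

theorem levelCard_zero : T.levelCard 0 = 1 := by
  rw [levelCard, Set.ncard_eq_one]
  refine ⟨T.rootEdge, ?_⟩
  ext α
  exact ⟨fun h => eq_of_level_eq_zero h level_rootEdge, fun h => by simp_all⟩

theorem levelCard_ne_zero (α : T.Edge) : T.levelCard (T.level α) ≠ 0 := by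
  intro h
  have h := (Set.ncard_eq_zero (finite_levelSet (T.level α))).1 h
  exact Set.eq_empty_iff_forall_notMem.1 h α rfl

theorem levelCard_succ {k d : ℕ} (h : ∀ α : T.Edge, T.level α = k → T.deg α = d) :
    T.levelCard (k + 1) = T.levelCard k * d := by
  have hfin : (T.levelSet k).Finite := finite_levelSet k
  have h1 : T.levelCard (k + 1) = (⋃ α ∈ T.levelSet k, children α).ncard := by
    rw [← levelSet_succ]; rfl
  classical
  have h3 : T.levelCard k = hfin.toFinset.card := Set.ncard_eq_toFinset_card _ hfin
  rw [h1, h3]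
  have h2 : (⋃ α ∈ T.levelSet k, children α) =
      ((hfin.toFinset.biUnion fun α => (finite_children α).toFinset : Finset T.Edge) :
        Set T.Edge) := by
    ext; simp
  rw [h2, Set.ncard_coe_finset, Finset.card_biUnion, Finset.sum_const_nat (m := d)]
  · intro α hα
    rw [← h α (hfin.mem_toFinset.1 hα)]
    exact (Set.ncard_eq_toFinset_card _ (finite_children α)).symm
  · intro α _ β _ hne
    refine Finset.disjoint_left.2 ?_
    intro γ h1 h2
    simp only [Set.Finite.mem_toFinset] at h1 h2
    exact hne (Edge.eq_of_e_eq (Eq.trans (Eq.symm h1) h2))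

/-! ### Geodesics, predecessor sets and boundary points -/

theorem vertexPred_root : T.vertexPred T.root = ∅ := by
  ext α
  simp only [vertexPred, Set.mem_ofPred_eq, Set.mem_empty_iff_false, iff_false]
  rintro ⟨q, hq, h⟩
  rw [SimpleGraph.Walk.isPath_iff_nil, ← SimpleGraph.Walk.eq_nil_iff_nil] at hq
  simp [hq] at h

theorem vertexPred_e (α : T.Edge) : T.vertexPred α.e = insert α (T.vertexPred α.b) := by
  obtain ⟨p, hp, hpl⟩ := T.isTree.connected.exists_path_of_dist T.root α.b
  have h1 : (p.concat α.adj).IsPath :=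
    SimpleGraph.Walk.isPath_of_length_eq_dist _ (by simp [hpl, α.dist_eq])
  ext β
  simp only [vertexPred, Set.mem_ofPred_eq, Set.mem_insert_iff]
  constructor
  · rintro ⟨q, hq, h⟩
    rw [(T.isTree.existsUnique_path _ _).unique hq h1, SimpleGraph.Walk.edges_concat] at h
    simp only [List.concat_eq_append, List.mem_append, List.mem_singleton] at h
    rcases h with h | h
    · exact Or.inr ⟨p, hp, h⟩
    · left
      rw [Sym2.eq_iff] at h
      rcases h with ⟨h, h'⟩ | ⟨h, h'⟩
      · exact Edge.ext h h'
      -- With the opposite orientation, each endpoint would be farther from the root than the other.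
      · have := α.dist_eq
        have := β.dist_eq
        rw [h, h'] at this
        omega
  · rintro (rfl | ⟨q, hq, h⟩)
    · exact ⟨_, h1, by simp [SimpleGraph.Walk.edges_concat]⟩
    · rw [(T.isTree.existsUnique_path _ _).unique hq hp] at h
      exact ⟨_, h1, by simp [SimpleGraph.Walk.edges_concat, h]⟩

theorem mem_vertexPred_e {α β : T.Edge} :
    β ∈ T.vertexPred α.e ↔ β = α ∨ ∃ γ : T.Edge, α.b = γ.e ∧ β ∈ T.vertexPred γ.e := by
  rw [vertexPred_e, Set.mem_insert_iff]
  refine or_congr_right ⟨fun h => ?_, fun ⟨γ, h1, h2⟩ => h1 ▸ h2⟩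
  have hb : α.b ≠ T.root := by
    intro hb
    rw [hb, vertexPred_root] at h
    exact h
  obtain ⟨γ, hγ⟩ := exists_edge_of_ne_root hb
  exact ⟨γ, hγ.symm, hγ ▸ h⟩

theorem edgeLE_refl (α : T.Edge) : T.edgeLE α α := mem_vertexPred_e.2 (Or.inl rfl)

theorem edgeLE_of_child {α β γ : T.Edge} (h : T.edgeLE α β) (hγ : γ.b = β.e) : T.edgeLE α γ :=
  mem_vertexPred_e.2 (Or.inr ⟨β, hγ, h⟩)

theorem children_eq_empty {α : T.Edge} (h : T.IsLeaf α) : children α = ∅ := by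
  refine Set.eq_empty_of_forall_notMem fun β hβ => ?_
  have h1 := level_of_b_eq_e hβ
  have h2 := h β (edgeLE_of_child (edgeLE_refl α) hβ)
  rw [h2] at h1
  omega

/-- Induction on the level: the parent of a further successor `β` of `α` would equal `α` by
hypothesis, making `β` a child. -/
theorem isLeaf_of_children_eq_empty {α : T.Edge} (h : children α = ∅) : T.IsLeaf α := by
  intro β
  induction hk : T.level β generalizing β with
  | zero =>
    intro hβ
    rcases mem_vertexPred_e.1 hβ with h1 | ⟨γ, h1, -⟩
    · exact h1.symm
    · have := level_of_b_eq_e h1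
      omega
  | succ k ih =>
    intro hβ
    rcases mem_vertexPred_e.1 hβ with h1 | ⟨γ, h1, h2⟩
    · exact h1.symm
    · have h3 := ih γ (by have := level_of_b_eq_e h1; omega) h2
      rw [h3] at h1
      exact absurd h1 (Set.eq_empty_iff_forall_notMem.1 h β)

/-- If `e` descends one edge at a time until it possibly stops, the edges preceding `e k` are the
`e i` with `i ≤ k`. -/
theorem mem_vertexPred_iff_of_descending {e : ℕ → T.Edge} {k : ℕ} (h0 : T.level (e 0) = 0)
    (hs : ∀ i < k, (e (i + 1)).b = (e i).e) {β : T.Edge} :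
    β ∈ T.vertexPred (e k).e ↔ ∃ i ≤ k, β = e i := by
  induction k with
  | zero =>
    rw [vertexPred_e, b_eq_root h0, vertexPred_root]
    simp
  | succ k ih =>
    rw [vertexPred_e, hs k (Nat.lt_succ_self k), Set.mem_insert_iff,
      ih fun i hi => hs i (hi.trans (Nat.lt_succ_self k))]
    constructor
    · rintro (h | ⟨i, hi, h⟩)
      · exact ⟨k + 1, le_rfl, h⟩
      · exact ⟨i, by omega, h⟩
    · rintro ⟨i, hi, h⟩
      rcases Nat.lt_or_ge k i with hk | hk
      · left
        rw [h, show i = k + 1 by omega]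
      · exact Or.inr ⟨i, hk, h⟩

theorem level_of_descending {e : ℕ → T.Edge} {k : ℕ} (h0 : T.level (e 0) = 0)
    (hs : ∀ i < k, (e (i + 1)).b = (e i).e) : ∀ i ≤ k, T.level (e i) = i := by
  intro i
  induction i with
  | zero => intro _; exact h0
  | succ i ih =>
    intro hi
    rw [level_of_b_eq_e (hs i (by omega)), ih (by omega)]

/-- Every edge is reached by a descending sequence from the root edge. -/
theorem exists_descending (α : T.Edge) : ∃ e : ℕ → T.Edge, T.level (e 0) = 0 ∧
    (∀ i < T.level α, (e (i + 1)).b = (e i).e) ∧ e (T.level α) = α := by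
  induction hk : T.level α generalizing α with
  | zero => exact ⟨fun _ => α, hk, by simp, rfl⟩
  | succ k ih =>
    obtain ⟨β, h1, h2⟩ := exists_parent hk
    obtain ⟨e, h3, h4, h5⟩ := ih β h2
    refine ⟨Function.update e (k + 1) α, ?_, ?_, by simp⟩
    · rwa [Function.update_of_ne (by omega)]
    · intro i hi
      rw [Function.update_of_ne (a := i) (by omega)]
      rcases Nat.lt_or_ge i k with h | h
      · rw [Function.update_of_ne (by omega)]
        exact h4 i h
      · obtain rfl : i = k := by omega
        rw [Function.update_self, h5, h1]

/-- Distances change by exactly one at each step. The first step back towards the root would have to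
return to the unique parent `x n`, against injectivity. -/
theorem dist_ray {x : ℕ → V} (zero : x 0 = T.root) (adj : ∀ n, T.graph.Adj (x n) (x (n + 1)))
    (inj : Function.Injective x) (n : ℕ) : T.graph.dist T.root (x n) = n := by
  induction n using Nat.strong_induction_on with
  | _ n ih =>
    match n with
    | 0 => simp [zero]
    | 1 => rw [← zero, SimpleGraph.dist_eq_one_iff_adj]; exact adj 0
    | n + 2 =>
      have h0 := ih n (by omega)
      have h1 := ih (n + 1) (by omega)
      have h : T.graph.dist T.root (x (n + 1)) = T.graph.dist T.root (x (n + 2)) + 1 ∨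
          T.graph.dist T.root (x (n + 2)) = T.graph.dist T.root (x (n + 1)) + 1 :=
        T.isTree.dist_eq_dist_add_one_of_adj T.root (adj (n + 1))
      rcases h with h | h
      · have := T.eq_of_adj_of_dist (adj n) (adj (n + 1)).symm (by omega) (by omega)
        have := inj this
        omega
      · omega

/-- The edges of `P(ζ)` are listed by a descending sequence, which stops exactly at a leaf. -/
theorem exists_descending_pred (ζ : T.Boundary) : ∃ (e : ℕ → T.Edge) (K : ℕ∞),
    T.level (e 0) = 0 ∧ (∀ i : ℕ, (i : ℕ∞) < K → (e (i + 1)).b = (e i).e) ∧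
    (∀ i : ℕ, (i : ℕ∞) = K → children (e i) = ∅) ∧
    ∀ β, β ∈ T.pred ζ ↔ ∃ i : ℕ, (i : ℕ∞) ≤ K ∧ β = e i := by
  cases ζ with
  | ray x zero adj inj =>
    have hd := dist_ray zero adj inj
    -- `K` is the index of the last edge: `⊤` for a ray, the level of the leaf otherwise.
    refine ⟨fun n => ⟨x n, x (n + 1), adj n, by rw [hd, hd]⟩, ⊤, ?_, ?_, ?_, ?_⟩
    · simp [level, zero]
    · intros; rfl
    · intro i hi; exact absurd hi (ENat.natCast_ne_top i)
    · intro β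
      simp only [pred, Set.mem_ofPred_eq, le_top, true_and, Edge.ext_iff]
  | leaf α hα =>
    obtain ⟨e, h1, h2, h3⟩ := exists_descending α
    refine ⟨e, T.level α, h1, ?_, ?_, ?_⟩
    · intro i hi; exact h2 i (by exact_mod_cast hi)
    · intro i hi
      rw [Nat.cast_inj.1 hi, h3]
      exact children_eq_empty hα
    · intro β
      have := mem_vertexPred_iff_of_descending h1 h2 (β := β)
      rw [h3] at this
      simpa [pred] using this

theorem level_of_descending_le {e : ℕ → T.Edge} {K : ℕ∞} (h0 : T.level (e 0) = 0)
    (hs : ∀ i : ℕ, (i : ℕ∞) < K → (e (i + 1)).b = (e i).e) {i : ℕ} (hi : (i : ℕ∞) ≤ K) :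
    T.level (e i) = i :=
  level_of_descending h0 (fun j hj => hs j (lt_of_lt_of_le (by exact_mod_cast hj) hi)) i le_rfl

theorem eq_of_mem_pred {ζ : T.Boundary} {α β : T.Edge} (hα : α ∈ T.pred ζ) (hβ : β ∈ T.pred ζ)
    (h : T.level α = T.level β) : α = β := by
  obtain ⟨e, K, h0, hs, -, hP⟩ := exists_descending_pred ζ
  obtain ⟨i, hi, rfl⟩ := (hP _).1 hα
  obtain ⟨j, hj, rfl⟩ := (hP _).1 hβ
  rw [level_of_descending_le h0 hs hi, level_of_descending_le h0 hs hj] at h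
  rw [h]

theorem mem_pred_of_child {ζ : T.Boundary} {α β : T.Edge} (hβ : β ∈ T.pred ζ)
    (h : β.b = α.e) : α ∈ T.pred ζ := by
  obtain ⟨e, K, h0, hs, -, hP⟩ := exists_descending_pred ζ
  obtain ⟨i, hi, rfl⟩ := (hP _).1 hβ
  have hl := level_of_descending_le h0 hs hi
  have hl' := level_of_b_eq_e h
  obtain ⟨j, rfl⟩ : ∃ j, i = j + 1 := ⟨T.level α, by omega⟩
  have hj : (j : ℕ∞) < K := lt_of_lt_of_le (by exact_mod_cast Nat.lt_succ_self j) hi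
  exact (hP _).2 ⟨j, hj.le, Edge.eq_of_e_eq (h.symm.trans (hs j hj))⟩

theorem rootEdge_mem_pred (ζ : T.Boundary) : T.rootEdge ∈ T.pred ζ := by
  obtain ⟨e, K, h0, hs, -, hP⟩ := exists_descending_pred ζ
  exact (hP _).2 ⟨0, by simp, eq_of_level_eq_zero level_rootEdge h0⟩

theorem tentBoundary_rootEdge : T.tentBoundary T.rootEdge = Set.univ :=
  Set.eq_univ_of_forall rootEdge_mem_pred

/-- If `P(ζ)` stopped at a level `K < k`, its last edge would have degree 0; by symmetry so would
every edge of level `K`, and all later levels would be empty. -/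
theorem exists_mem_pred_level (hT : T.IsSphericallySymmetric) (ζ : T.Boundary) {k : ℕ}
    (hk : T.levelCard k ≠ 0) : ∃ α ∈ T.pred ζ, T.level α = k := by
  obtain ⟨e, K, h0, hs, hK, hP⟩ := exists_descending_pred ζ
  rcases le_or_gt (k : ℕ∞) K with h | h
  · exact ⟨e k, (hP _).2 ⟨k, h, rfl⟩, level_of_descending_le h0 hs h⟩
  · exfalso
    lift K to ℕ using h.ne_top
    have hl : T.level (e K) = K := level_of_descending_le h0 hs le_rfl
    have hz : ∀ m, T.levelCard (K + m + 1) = 0 := by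
      intro m
      induction m with
      | zero =>
        rw [levelCard_succ (d := 0), mul_zero]
        intro α hα
        rw [hT α (e K) (by rw [hl]; exact hα), deg_eq_zero_iff]
        exact hK K rfl
      | succ m ih =>
        rw [levelCard_succ (d := 0), mul_zero]
        intro α hα
        exact absurd ih (by rw [← add_assoc] at hα; rw [← hα]; exact levelCard_ne_zero α)
    have h : K < k := by exact_mod_cast h
    obtain ⟨m, rfl⟩ := Nat.exists_eq_add_of_lt h
    exact hk (hz m)

/-- In a spherically symmetric tree, every boundary point has one predecessor at each level. -/
def predEquivLevel (hT : T.IsSphericallySymmetric) (ζ : T.Boundary) :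
    T.pred ζ ≃ {k : ℕ // T.levelCard k ≠ 0} :=
  Equiv.ofBijective (fun α => ⟨T.level α, levelCard_ne_zero _⟩) ⟨by
    rintro ⟨α, hα⟩ ⟨β, hβ⟩ h
    exact Subtype.ext (eq_of_mem_pred hα hβ (congrArg Subtype.val h)), by
    rintro ⟨k, hk⟩
    obtain ⟨α, h1, h2⟩ := exists_mem_pred_level hT ζ hk
    exact ⟨⟨α, h1⟩, Subtype.ext h2⟩⟩

/-- A sequence of edges which descends from the root edge, and stops only at leaves, has a limit
in the boundary. -/
theorem exists_boundary_of_descending {e : ℕ → T.Edge} (h0 : T.level (e 0) = 0)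
    (hs : ∀ i, (e (i + 1)).b = (e i).e ∨ children (e i) = ∅ ∧ e (i + 1) = e i) :
    ∃ ζ : T.Boundary, ∀ α, α ∈ T.pred ζ ↔ e (T.level α) = α := by
  classical
  by_cases h : ∃ i, children (e i) = ∅
  · set K := Nat.find h with hKdef
    have hK : children (e K) = ∅ := Nat.find_spec h
    have hlt : ∀ i < K, (e (i + 1)).b = (e i).e := fun i hi =>
      (hs i).resolve_right fun hc => Nat.find_min h hi hc.1
    have hconst : ∀ m, e (K + m) = e K := by
      intro m
      induction m with
      | zero => rfl
      | succ m ih =>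
        rcases hs (K + m) with h1 | h1
        · rw [ih] at h1
          exact absurd h1 (Set.eq_empty_iff_forall_notMem.1 hK (e (K + m + 1)))
        · exact h1.2.trans ih
    have hl := level_of_descending h0 hlt
    refine ⟨.leaf (e K) (isLeaf_of_children_eq_empty hK), fun α => ?_⟩
    simp only [pred]
    rw [mem_vertexPred_iff_of_descending h0 hlt]
    constructor
    · rintro ⟨i, hi, rfl⟩
      rw [hl i hi]
    -- From `K` on the sequence stays at `e K`, of level `K`, so it cannot meet an edge of higher
    -- level.
    · intro hα
      refine ⟨T.level α, ?_, hα.symm⟩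
      by_contra hc
      obtain ⟨m, hm⟩ := Nat.exists_eq_add_of_le (not_le.1 hc).le
      rw [hm, hconst] at hα
      rw [← hα, hl K le_rfl] at hc
      exact hc le_rfl
  · have hs' : ∀ i, (e (i + 1)).b = (e i).e := fun i =>
      (hs i).resolve_right fun hc => h ⟨i, hc.1⟩
    have hl : ∀ i, T.level (e i) = i := fun i =>
      level_of_descending h0 (fun j _ => hs' j) i le_rfl
    refine ⟨.ray (fun n => (e n).b) (b_eq_root h0) (fun n => ?_) ?_, fun α => ?_⟩
    · show T.graph.Adj (e n).b (e (n + 1)).b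
      rw [hs' n]; exact (e n).adj
    · intro i j hij
      have : T.level (e i) = T.level (e j) := congrArg (T.graph.dist T.root) hij
      rwa [hl, hl] at this
    · simp only [pred, Set.mem_ofPred_eq]
      constructor
      · rintro ⟨n, h1, h2⟩
        have : α = e n := Edge.ext h1 (h2.trans (hs' n))
        rw [this, hl]
      · intro hα
        refine ⟨T.level α, ?_, ?_⟩
        · rw [hα]
        · show α.e = (e (T.level α + 1)).b
          rw [hs', hα]

end Edges

/-! ### Tents as a π-system, and the uniform measure on the boundary -/

section BoundaryMeasure

variable {V : Type*} {T : RootEdgeTree V}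

instance : SecondCountableTopology T.Boundary :=
  ⟨⟨Set.range T.tentBoundary, Set.countable_range _, rfl⟩⟩

variable (T) in
-- There are only countably many edges, so the tents, a countable subbasis, generate the Borel sets.
theorem measurableSpace_boundary_eq :
    (instMeasurableSpaceBoundary T : MeasurableSpace T.Boundary) =
      MeasurableSpace.generateFrom (Set.range T.tentBoundary) :=
  borel_eq_generateFrom_of_subbasis rfl

theorem measurableSet_tentBoundary (α : T.Edge) : MeasurableSet (T.tentBoundary α) := by
  rw [measurableSpace_boundary_eq T]
  exact MeasurableSpace.measurableSet_generateFrom ⟨α, rfl⟩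

theorem tentBoundary_subset_of_child {α β : T.Edge} (h : β.b = α.e) :
    T.tentBoundary β ⊆ T.tentBoundary α := fun _ hζ => mem_pred_of_child hζ h

/-- Climbing from `β` to the level of `α` keeps a common boundary point, which has only one
predecessor at that level. Hence tents are nested or disjoint. -/
theorem tentBoundary_subset_of_level_le {α β : T.Edge} (h : T.level α ≤ T.level β)
    (hne : (T.tentBoundary α ∩ T.tentBoundary β).Nonempty) :
    T.tentBoundary β ⊆ T.tentBoundary α := by
  obtain ⟨n, hn⟩ := Nat.exists_eq_add_of_le h
  induction n generalizing β with
  | zero =>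
    obtain ⟨ζ, h1, h2⟩ := hne
    rw [eq_of_mem_pred h1 h2 hn.symm]
  | succ n ih =>
    obtain ⟨γ, h1, h2⟩ := exists_parent hn
    have hsub := tentBoundary_subset_of_child h1
    exact hsub.trans (ih
      (h2 ▸ Nat.le_add_right _ _) (hne.mono (Set.inter_subset_inter_right _ hsub)) h2)

variable (T) in
theorem isPiSystem_tentBoundary : IsPiSystem (Set.range T.tentBoundary) := by
  rintro _ ⟨α, rfl⟩ _ ⟨β, rfl⟩ hne
  rcases le_total (T.level α) (T.level β) with h | h
  · rw [Set.inter_eq_self_of_subset_right (tentBoundary_subset_of_level_le h hne)]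
    exact ⟨β, rfl⟩
  · rw [Set.inter_comm] at hne
    rw [Set.inter_eq_self_of_subset_left (tentBoundary_subset_of_level_le h hne)]
    exact ⟨α, rfl⟩

/-- A finite measure on the boundary is determined by its co-potential. -/
theorem measure_ext_of_copotential {μ ν : Measure T.Boundary} [IsFiniteMeasure μ]
    [IsFiniteMeasure ν] (h : ∀ α, T.copotential μ α = T.copotential ν α) : μ = ν := by
  have h' : ∀ α, μ (T.tentBoundary α) = ν (T.tentBoundary α) := fun α =>
    (measureReal_eq_measureReal_iff).1 (h α)
  refine ext_of_generate_finite _ (measurableSpace_boundary_eq T) (isPiSystem_tentBoundary T) ?_ ?_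
  · rintro _ ⟨α, rfl⟩
    exact h' α
  · rw [← tentBoundary_rootEdge]
    exact h' _

/-- The possible successors of `α` in a descending walk which stops at leaves. -/
abbrev Successor (α : T.Edge) : Type _ := {β : T.Edge // β ∈ children α ∨ children α = ∅ ∧ β = α}

instance (α : T.Edge) : Finite (Successor α) :=
  (((finite_children α).union (Set.finite_singleton α)).subset fun _ hβ =>
    hβ.imp_right And.right : {β | β ∈ children α ∨ children α = ∅ ∧ β = α}.Finite)

instance (α : T.Edge) : Nonempty (Successor α) := by
  rcases (children α).eq_empty_or_nonempty with h | ⟨β, hβ⟩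
  · exact ⟨⟨α, Or.inr ⟨h, rfl⟩⟩⟩
  · exact ⟨⟨β, Or.inl hβ⟩⟩

instance (α : T.Edge) : MeasurableSpace (Successor α) := ⊤

instance (α : T.Edge) : DiscreteMeasurableSpace (Successor α) := ⟨fun _ => trivial⟩

theorem card_successor {α : T.Edge} (h : (children α).Nonempty) :
    Nat.card (Successor α) = T.deg α := by
  show Nat.card {β // β ∈ children α ∨ children α = ∅ ∧ β = α} = (children α).ncard
  rw [← Nat.card_coe_set_eq]
  refine Nat.card_congr (Equiv.subtypeEquivRight fun β => ?_)
  simp [h.ne_empty]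

/-- The uniform distribution on the successors of `α`. -/
def uniformSuccessor (α : T.Edge) : Measure (Successor α) := ProbabilityTheory.uniformOn Set.univ

instance (α : T.Edge) : IsProbabilityMeasure (uniformSuccessor α) :=
  ProbabilityTheory.isProbabilityMeasure_uniformOn Set.finite_univ Set.univ_nonempty

theorem uniformSuccessor_singleton {α : T.Edge} (h : (children α).Nonempty) (β : Successor α) :
    uniformSuccessor α {β} = (T.deg α : ℝ≥0∞)⁻¹ := by
  have := Fintype.ofFinite (Successor α)
  rw [uniformSuccessor, ProbabilityTheory.uniformOn_univ, Measure.count_singleton,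
    ← Nat.card_eq_fintype_card, card_successor h, one_div]

/-- The descending walk from the root edge directed by a choice of successors. -/
def walk (s : ∀ α : T.Edge, Successor α) : ℕ → T.Edge
  | 0 => T.rootEdge
  | k + 1 => (s (walk s k)).1

theorem level_walk_le (s : ∀ α : T.Edge, Successor α) (k : ℕ) : T.level (walk s k) ≤ k := by
  induction k with
  | zero => simp [walk]
  | succ k ih =>
    rcases (s (walk s k)).2 with h | h
    · have := level_of_b_eq_e h
      show T.level (s (walk s k)).1 ≤ k + 1
      omega
    · show T.level (s (walk s k)).1 ≤ k + 1
      rw [h.2]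
      omega

/-- The level hypothesis excludes a walk resting at the leaf `α`: at time `k` it has level at most
`k`. -/
theorem walk_succ_eq_iff {s : ∀ α : T.Edge, Successor α} {k : ℕ} {α β : T.Edge}
    (hα : T.level α = k + 1) (h : α ∈ children β) :
    walk s (k + 1) = α ↔ walk s k = β ∧ s β = ⟨α, Or.inl h⟩ := by
  constructor
  · intro hw
    have hw : (s (walk s k)).1 = α := hw
    have hβ : walk s k = β := by
      rcases (s (walk s k)).2 with h1 | h1
      · rw [hw] at h1
        exact Edge.eq_of_e_eq (Eq.trans (Eq.symm h1) h)
      · have := level_walk_le s k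
        rw [← h1.2, hw] at this
        omega
    refine ⟨hβ, Subtype.ext ?_⟩
    rw [hβ] at hw
    exact hw
  · rintro ⟨h1, h2⟩
    show (s (walk s k)).1 = α
    rw [h1, h2]

/-- Reaching `α` on time prescribes the choice at each edge strictly preceding it and nothing else.
The event is thus a finite-dimensional box, of probability the product of the 1/deg along the
geodesic, which by symmetry is 1/N_k. -/
theorem exists_box_walk_eq (hT : T.IsSphericallySymmetric) (k : ℕ) (α : T.Edge)
    (hα : T.level α = k) : ∃ (F : Finset T.Edge) (t : ∀ γ : T.Edge, Set (Successor γ)),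
      (∀ γ ∈ F, T.level γ < k) ∧ {s | walk s k = α} = Set.pi F t ∧
      ∏ γ ∈ F, uniformSuccessor γ (t γ) = (T.levelCard k : ℝ≥0∞)⁻¹ := by
  classical
  induction k generalizing α with
  | zero =>
    refine ⟨∅, fun _ => ∅, by simp, ?_, by simp [levelCard_zero]⟩
    rw [Finset.coe_empty, Set.empty_pi]
    exact Set.eq_univ_of_forall fun s => eq_of_level_eq_zero level_rootEdge hα
  | succ k ih =>
    obtain ⟨β, h1, h2⟩ := exists_parent hα
    obtain ⟨F, t, hF, hbox, hprod⟩ := ih β h2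
    -- The parent is a new coordinate, so one factor 1/deg is added to the product.
    have hβ : β ∉ F := fun h => by have := hF β h; omega
    have hne : ∀ γ ∈ F, γ ≠ β := fun γ hγ h => hβ (h ▸ hγ)
    have hmem : α ∈ children β := h1
    refine ⟨insert β F, Function.update t β {⟨α, Or.inl hmem⟩}, ?_, ?_, ?_⟩
    · intro γ hγ
      rcases Finset.mem_insert.1 hγ with rfl | h
      · omega
      · have := hF γ h
        omega
    · rw [Finset.coe_insert, Set.insert_pi, Function.update_self]
      have : Set.pi (F : Set T.Edge) (Function.update t β {⟨α, Or.inl hmem⟩}) = Set.pi F t :=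
        Set.pi_congr rfl fun γ hγ => Function.update_of_ne (hne γ hγ) _ _
      rw [this, ← hbox]
      ext s
      rw [Set.mem_ofPred_eq, walk_succ_eq_iff hα hmem]
      exact and_comm
    · rw [Finset.prod_insert hβ, Function.update_self, uniformSuccessor_singleton ⟨α, hmem⟩,
        Finset.prod_congr rfl fun γ hγ => by rw [Function.update_of_ne (hne γ hγ)], hprod,
        levelCard_succ (d := T.deg β) fun γ hγ => hT γ β (hγ.trans h2.symm), Nat.cast_mul,
        mul_comm, ENNReal.mul_inv (Or.inr (ENNReal.natCast_ne_top _))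
          (Or.inl (ENNReal.natCast_ne_top _))]

theorem exists_limit_walk (s : ∀ α : T.Edge, Successor α) :
    ∃ ζ : T.Boundary, ∀ α, α ∈ T.pred ζ ↔ walk s (T.level α) = α :=
  exists_boundary_of_descending (e := walk s) level_rootEdge fun i => (s (walk s i)).2

/-- The boundary point to which a descending walk converges. -/
def limitWalk (s : ∀ α : T.Edge, Successor α) : T.Boundary := (exists_limit_walk s).choose

theorem preimage_limitWalk (α : T.Edge) :
    limitWalk ⁻¹' T.tentBoundary α = {s | walk s (T.level α) = α} :=
  Set.ext fun s => (exists_limit_walk s).choose_spec α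

theorem measurable_limitWalk (hT : T.IsSphericallySymmetric) :
    Measurable (limitWalk : (∀ α : T.Edge, Successor α) → T.Boundary) := by
  rw [measurableSpace_boundary_eq T]
  refine measurable_generateFrom ?_
  rintro _ ⟨α, rfl⟩
  obtain ⟨F, t, -, hbox, -⟩ := exists_box_walk_eq hT _ α rfl
  rw [preimage_limitWalk, hbox]
  exact MeasurableSet.pi F.countable_toSet fun γ _ => MeasurableSet.of_discrete

variable (T) in
/-- The uniform distribution on the boundary: the law of the limit of the descending random
walk. -/
def uniformBoundary : Measure T.Boundary :=
  (Measure.infinitePi fun α : T.Edge => uniformSuccessor α).map limitWalk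

theorem uniformBoundary_tentBoundary (hT : T.IsSphericallySymmetric) (α : T.Edge) :
    T.uniformBoundary (T.tentBoundary α) = (T.levelCard (T.level α) : ℝ≥0∞)⁻¹ := by
  obtain ⟨F, t, -, hbox, hprod⟩ := exists_box_walk_eq hT _ α rfl
  rw [uniformBoundary, Measure.map_apply (measurable_limitWalk hT) (measurableSet_tentBoundary α),
    preimage_limitWalk, hbox, Measure.infinitePi_pi _ fun γ _ => MeasurableSet.of_discrete, hprod]

theorem uniformBoundary_univ (hT : T.IsSphericallySymmetric) :
    T.uniformBoundary Set.univ = 1 := by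
  rw [← tentBoundary_rootEdge, uniformBoundary_tentBoundary hT, level_rootEdge, levelCard_zero]
  simp

end BoundaryMeasure

/-! ### Radial sums, potentials and Hölder's inequality -/

section Capacities

variable {V : Type*} {T : RootEdgeTree V} {p : ℝ}

theorem toReal_exponent (hp : 1 < p) : (ENNReal.ofReal p).toReal = p :=
  ENNReal.toReal_ofReal (by linarith)

section Norm

variable [hp : Fact (1 < p)]

theorem norm_rpow_eq_tsum (f : T.EdgeLp p) : ‖f‖ ^ p = ∑' α, |f α| ^ p := by
  have h := lp.norm_rpow_eq_tsum (p := ENNReal.ofReal p)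
    (by rw [toReal_exponent hp.out]; linarith [hp.out]) f
  simpa only [toReal_exponent hp.out, Real.norm_eq_abs] using h

theorem summable_abs_rpow (f : T.EdgeLp p) : Summable fun α => |f α| ^ p := by
  have h := (lp.memℓp f).summable (by rw [toReal_exponent hp.out]; linarith [hp.out])
  simpa only [toReal_exponent hp.out, Real.norm_eq_abs] using h

theorem ofReal_norm_rpow (f : T.EdgeLp p) :
    ENNReal.ofReal (‖f‖ ^ p) = ∑' α, ENNReal.ofReal |f α| ^ p := by
  rw [norm_rpow_eq_tsum, ENNReal.ofReal_tsum_of_nonneg (fun α => by positivity)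
    (summable_abs_rpow f)]
  exact tsum_congr fun α =>
    (ENNReal.ofReal_rpow_of_nonneg (abs_nonneg _) (by linarith [hp.out])).symm

end Norm

variable (T p) in
/-- The sum `∑ N_k ^ (1 - p')` over the nonempty levels. -/
def levelSum : ℝ≥0∞ :=
  ∑' k : {k : ℕ // T.levelCard k ≠ 0}, (T.levelCard k : ℝ≥0∞) ^ (1 - p.conjExponent)

theorem one_le_levelSum : 1 ≤ T.levelSum p := by
  refine le_trans ?_ (ENNReal.le_tsum ⟨0, by simp [levelCard_zero]⟩)
  simp [levelCard_zero]

/-- Summing a radial function over the edges. -/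
theorem tsum_radial (g : ℕ → ℝ≥0∞) : ∑' α : T.Edge, g (T.level α) =
    ∑' k : {k : ℕ // T.levelCard k ≠ 0}, (T.levelCard k : ℝ≥0∞) * g k := by
  let lev : T.Edge → {k : ℕ // T.levelCard k ≠ 0} := fun α => ⟨T.level α, levelCard_ne_zero α⟩
  rw [← (Equiv.sigmaFiberEquiv lev).tsum_eq, ENNReal.tsum_sigma']
  refine tsum_congr fun k => ?_
  have hg : ∀ x : {α // lev α = k}, g (T.level (Equiv.sigmaFiberEquiv lev ⟨k, x⟩)) = g k := by
    rintro ⟨α, rfl⟩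
    rfl
  simp_rw [hg]
  have : Finite {α // lev α = k} :=
    ((finite_levelSet k.1).subset fun α (h : lev α = k) => congrArg Subtype.val h :
      {α | lev α = k}.Finite)
  have := Fintype.ofFinite {α // lev α = k}
  rw [tsum_fintype, Finset.sum_const, nsmul_eq_mul, Finset.card_univ, ← Nat.card_eq_fintype_card]
  congr 2
  show Nat.card {α // lev α = k} = {α : T.Edge | T.level α = k}.ncard
  rw [← Nat.card_coe_set_eq]
  exact Nat.card_congr (Equiv.subtypeEquivRight fun α => Subtype.ext_iff)

theorem potential_radial (hT : T.IsSphericallySymmetric) {f : T.Edge → ℝ} {g : ℕ → ℝ≥0∞}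
    (h : ∀ α, ENNReal.ofReal (f α) = g (T.level α)) (ζ : T.Boundary) :
    T.potential f ζ = ∑' k : {k : ℕ // T.levelCard k ≠ 0}, g k := by
  rw [potential, ← (predEquivLevel hT ζ).tsum_eq]
  exact tsum_congr fun α => h α

/-- Tonelli: the potential is a sum of indicators of tents, weighted by `f`. -/
theorem lintegral_potential (hT : T.IsSphericallySymmetric) (f : T.Edge → ℝ) :
    ∫⁻ ζ, T.potential f ζ ∂T.uniformBoundary =
      ∑' α, ENNReal.ofReal (f α) * (T.levelCard (T.level α) : ℝ≥0∞)⁻¹ := by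
  have h : ∀ ζ, T.potential f ζ =
      ∑' α, (T.tentBoundary α).indicator (fun _ => ENNReal.ofReal (f α)) ζ := by
    intro ζ
    rw [potential, tsum_subtype (T.pred ζ) fun α => ENNReal.ofReal (f α)]
    rfl
  simp_rw [h]
  rw [lintegral_tsum fun α =>
    (measurable_const.indicator (measurableSet_tentBoundary α)).aemeasurable]
  refine tsum_congr fun α => ?_
  rw [lintegral_indicator_const (measurableSet_tentBoundary α), uniformBoundary_tentBoundary hT]

theorem tsum_mul_le_Lp_mul_Lq {ι : Type*} {q : ℝ} (hpq : p.HolderConjugate q) (f g : ι → ℝ≥0∞) :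
    ∑' i, f i * g i ≤ (∑' i, f i ^ p) ^ (1 / p) * (∑' i, g i ^ q) ^ (1 / q) := by
  let _ : MeasurableSpace ι := ⊤
  have h := ENNReal.lintegral_mul_le_Lp_mul_Lq (Measure.count : Measure ι) hpq
    (f := f) (g := g) measurable_from_top.aemeasurable measurable_from_top.aemeasurable
  simpa only [lintegral_count, Pi.mul_apply] using h

theorem mul_inv_rpow_eq {N : ℕ} (hN : N ≠ 0) :
    (N : ℝ≥0∞) * ((N : ℝ≥0∞)⁻¹) ^ p.conjExponent = (N : ℝ≥0∞) ^ (1 - p.conjExponent) := by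
  rw [ENNReal.rpow_sub _ _ (by exact_mod_cast hN) (ENNReal.natCast_ne_top N), ENNReal.rpow_one,
    ENNReal.inv_rpow, div_eq_mul_inv]

theorem capacity_le_of_mem {E : Set T.Boundary} {f : T.EdgeLp p} (hf : f ∈ T.testFunctions p E) :
    T.capacity p E ≤ ENNReal.ofReal (‖f‖ ^ p) := iInf₂_le f hf

theorem potential_add_smul {f g : T.Edge → ℝ} (hf : ∀ α, 0 ≤ f α) (hg : ∀ α, 0 ≤ g α) {a b : ℝ}
    (ha : 0 ≤ a) (hb : 0 ≤ b) (ζ : T.Boundary) :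
    T.potential (fun α => a * f α + b * g α) ζ =
      ENNReal.ofReal a * T.potential f ζ + ENNReal.ofReal b * T.potential g ζ := by
  simp only [potential]
  rw [← ENNReal.tsum_mul_left, ← ENNReal.tsum_mul_left, ← ENNReal.tsum_add]
  refine tsum_congr fun α => ?_
  rw [ENNReal.ofReal_add (mul_nonneg ha (hf _)) (mul_nonneg hb (hg _)), ENNReal.ofReal_mul ha,
    ENNReal.ofReal_mul hb]

theorem convex_testFunctions (E : Set T.Boundary) : Convex ℝ (T.testFunctions p E) := by
  intro f hf g hg a b ha hb hab
  refine ⟨fun α => ?_, fun ζ hζ => ?_⟩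
  · exact add_nonneg (mul_nonneg ha (hf.1 α)) (mul_nonneg hb (hg.1 α))
  · calc (1 : ℝ≥0∞) = ENNReal.ofReal a * 1 + ENNReal.ofReal b * 1 := by
          rw [mul_one, mul_one, ← ENNReal.ofReal_add ha hb, hab, ENNReal.ofReal_one]
      _ ≤ ENNReal.ofReal a * T.potential f ζ + ENNReal.ofReal b * T.potential g ζ := by
          gcongr
          · exact hf.2 ζ hζ
          · exact hg.2 ζ hζ
      _ = _ := (potential_add_smul hf.1 hg.1 ha hb ζ).symm

/-- Geometric series with N_k = n^k; for `n = 1` both sides are `∞`. -/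
theorem levelSum_of_isHomogeneous {n : ℕ} (hn : 1 ≤ n) (hT : T.IsHomogeneous n) :
    T.levelSum p = (1 - (n : ℝ≥0∞) ^ (1 - p.conjExponent))⁻¹ := by
  have hN : ∀ k, T.levelCard k = n ^ k := by
    intro k
    induction k with
    | zero => rw [levelCard_zero, pow_zero]
    | succ k ih => rw [levelCard_succ fun α _ => hT α, ih, pow_succ]
  have hN0 : ∀ k, T.levelCard k ≠ 0 := fun k => by
    rw [hN]
    exact pow_ne_zero _ (by omega)
  rw [levelSum, ← ENNReal.tsum_geometric, ← (Equiv.subtypeUnivEquiv hN0).tsum_eq]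
  refine tsum_congr fun k => ?_
  rw [hN, Nat.cast_pow, ← ENNReal.rpow_natCast, ← ENNReal.rpow_mul, mul_comm, ENNReal.rpow_mul,
    ENNReal.rpow_natCast]
  rfl

/-! ### The capacity formula -/

section Capacity

variable [hp : Fact (1 < p)]

/-- Hölder applied to the potential integrated against the uniform measure. The dual factor is the
level sum, since level k contributes N_k · N_k^{-p'}. -/
theorem levelSum_rpow_le (hT : T.IsSphericallySymmetric) {f : T.EdgeLp p}
    (hf : f ∈ T.testFunctions p Set.univ) :
    T.levelSum p ^ (1 - p) ≤ ENNReal.ofReal (‖f‖ ^ p) := by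
  have hpq := Real.HolderConjugate.conjExponent hp.out
  have hp0 : 0 < p := hpq.pos
  have h1 : 1 ≤ ∫⁻ ζ, T.potential f ζ ∂T.uniformBoundary := by
    calc (1 : ℝ≥0∞) = ∫⁻ _, 1 ∂T.uniformBoundary := by
          rw [lintegral_one, uniformBoundary_univ hT]
      _ ≤ _ := lintegral_mono fun ζ => hf.2 ζ trivial
  rw [lintegral_potential hT] at h1
  have h2 := h1.trans (tsum_mul_le_Lp_mul_Lq hpq _ _)
  have h3 : ∑' α : T.Edge, ((T.levelCard (T.level α) : ℝ≥0∞)⁻¹) ^ p.conjExponent =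
      T.levelSum p := by
    rw [tsum_radial fun k => ((T.levelCard k : ℝ≥0∞)⁻¹) ^ p.conjExponent]
    exact tsum_congr fun k => mul_inv_rpow_eq k.2
  have h4 : ∑' α, ENNReal.ofReal (f α) ^ p = ENNReal.ofReal (‖f‖ ^ p) := by
    rw [ofReal_norm_rpow]
    exact tsum_congr fun α => by rw [abs_of_nonneg (hf.1 α)]
  rw [h3, h4] at h2
  have h5 := ENNReal.rpow_le_rpow h2 hp0.le
  rw [ENNReal.one_rpow, ENNReal.mul_rpow_of_nonneg _ _ hp0.le, ← ENNReal.rpow_mul,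
    ← ENNReal.rpow_mul, one_div_mul_cancel hp0.ne', ENNReal.rpow_one,
    show 1 / p.conjExponent * p = p - 1 by
      rw [Real.conjExponent]; field_simp] at h5
  rw [show 1 - p = -(p - 1) by ring, ENNReal.rpow_neg, ENNReal.inv_le_iff_le_mul]
  · rwa [mul_comm]
  · intro _ h
    rw [ENNReal.rpow_eq_zero_iff] at h
    have := one_le_levelSum (T := T) (p := p)
    rcases h with ⟨h, -⟩ | ⟨-, h⟩
    · simp [h] at this
    · linarith [hp.out]
  -- Since `0 * ∞ = 0`, a vanishing norm contradicts `h5` even when the level sum diverges.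
  · intro _ h
    simp [h] at h5

/-- Radial test functions. -/
theorem exists_radial_testFunction (hT : T.IsSphericallySymmetric) {g : ℕ → ℝ≥0∞}
    (hg : ∀ k, g k ≠ ∞) (h1 : 1 ≤ ∑' k : {k : ℕ // T.levelCard k ≠ 0}, g k)
    (h2 : ∑' k : {k : ℕ // T.levelCard k ≠ 0}, (T.levelCard k : ℝ≥0∞) * g k ^ p ≠ ∞) :
    ∃ f ∈ T.testFunctions p Set.univ, (∀ α, f α = (g (T.level α)).toReal) ∧
      ENNReal.ofReal (‖f‖ ^ p) =
        ∑' k : {k : ℕ // T.levelCard k ≠ 0}, (T.levelCard k : ℝ≥0∞) * g k ^ p := by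
  rw [← tsum_radial fun k => g k ^ p] at h2 ⊢
  have hmem : Memℓp (fun α : T.Edge => (g (T.level α)).toReal) (ENNReal.ofReal p) := by
    refine memℓp_gen ?_
    rw [toReal_exponent hp.out]
    refine (ENNReal.summable_toReal h2).congr fun α => ?_
    rw [Real.norm_eq_abs, abs_of_nonneg ENNReal.toReal_nonneg, ENNReal.toReal_rpow]
  let f : T.EdgeLp p := ⟨_, hmem⟩
  have hf : ∀ α, f α = (g (T.level α)).toReal := fun α => rfl
  have hf' : ∀ α, ENNReal.ofReal (f α) = g (T.level α) := fun α => by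
    rw [hf, ENNReal.ofReal_toReal (hg _)]
  refine ⟨f, ⟨fun α => ENNReal.toReal_nonneg, fun ζ _ => ?_⟩, hf, ?_⟩
  · rwa [potential_radial hT hf']
  · rw [ofReal_norm_rpow]
    refine tsum_congr fun α => ?_
    rw [abs_of_nonneg (by rw [hf]; exact ENNReal.toReal_nonneg), hf']

/-- The optimal radial test function among those carried by the levels in `A`. -/
theorem exists_testFunction_levels (hT : T.IsSphericallySymmetric) (A : Set ℕ) {S : ℝ≥0∞}
    (hS : ∑' k : {k : ℕ // T.levelCard k ≠ 0},
      A.indicator (fun k => (T.levelCard k : ℝ≥0∞) ^ (1 - p.conjExponent)) k = S)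
    (hS0 : S ≠ 0) (hSt : S ≠ ∞) :
    ∃ f ∈ T.testFunctions p Set.univ,
      (∀ α, f α = (S⁻¹ * A.indicator
        (fun k => (T.levelCard k : ℝ≥0∞) ^ (1 - p.conjExponent)) (T.level α)).toReal) ∧
      ENNReal.ofReal (‖f‖ ^ p) = S ^ (1 - p) := by
  have hpq := Real.HolderConjugate.conjExponent hp.out
  have hp0 : 0 < p := hpq.pos
  set W : ℕ → ℝ≥0∞ := A.indicator fun k => (T.levelCard k : ℝ≥0∞) ^ (1 - p.conjExponent) with hW
  -- The exponent reproduces itself: N · (N^{1-p'})^p = N^{1-p'}, because p + p' = pp'. The norm is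
  -- therefore again governed by `S`.
  have hterm : ∀ k : {k : ℕ // T.levelCard k ≠ 0},
      (T.levelCard k : ℝ≥0∞) * (S⁻¹ * W k) ^ p = S ^ (-p) * W k := by
    intro k
    have hN : (T.levelCard k : ℝ≥0∞) ≠ 0 := by exact_mod_cast k.2
    by_cases hk : (k : ℕ) ∈ A
    · rw [hW, Set.indicator_of_mem hk, ENNReal.mul_rpow_of_nonneg _ _ hp0.le, ENNReal.inv_rpow,
        ← ENNReal.rpow_neg, mul_left_comm, ← ENNReal.rpow_mul]
      congr 1
      nth_rewrite 1 [← ENNReal.rpow_one (T.levelCard k : ℝ≥0∞)]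
      rw [← ENNReal.rpow_add _ _ hN (ENNReal.natCast_ne_top _)]
      congr 1
      linarith [hpq.mul_eq_add]
    · rw [hW, Set.indicator_of_notMem hk, mul_zero, ENNReal.zero_rpow_of_pos hp0, mul_zero,
        mul_zero]
  have hsum : ∑' k : {k : ℕ // T.levelCard k ≠ 0}, (T.levelCard k : ℝ≥0∞) * (S⁻¹ * W k) ^ p =
      S ^ (1 - p) := by
    simp_rw [hterm]
    rw [ENNReal.tsum_mul_left, hS]
    nth_rewrite 2 [← ENNReal.rpow_one S]
    rw [← ENNReal.rpow_add _ _ hS0 hSt]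
    congr 1
    ring
  have hWt : ∀ k : ℕ, T.levelCard k ≠ 0 → W k ≠ ∞ := fun k hk =>
    ne_top_of_le_ne_top hSt (hS ▸ ENNReal.le_tsum (⟨k, hk⟩ : {k : ℕ // T.levelCard k ≠ 0}))
  classical
  obtain ⟨f, h1, h2, h3⟩ := exists_radial_testFunction (p := p) hT
    -- On empty levels the weight 0^{1-p'} may be `∞`, so it is replaced by 0 to keep `g` finite
    -- everywhere.
    (g := fun k => if T.levelCard k = 0 then 0 else S⁻¹ * W k) (fun k => by
      split_ifs with h
      · simp
      · exact ENNReal.mul_ne_top (ENNReal.inv_ne_top.2 hS0) (hWt k h))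
    (by
      rw [tsum_congr fun k : {k : ℕ // T.levelCard k ≠ 0} => if_neg k.2, ENNReal.tsum_mul_left, hS,
        ENNReal.inv_mul_cancel hS0 hSt])
    (by
      rw [tsum_congr fun k : {k : ℕ // T.levelCard k ≠ 0} => by rw [if_neg k.2], hsum]
      exact ENNReal.rpow_ne_top_of_ne_zero hS0 hSt)
  refine ⟨f, h1, fun α => by rw [h2, if_neg (levelCard_ne_zero α)], ?_⟩
  rw [h3, tsum_congr fun k : {k : ℕ // T.levelCard k ≠ 0} => by rw [if_neg k.2], hsum]

/-- The upper bound uses finite sets of levels, where the optimal radial function is always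
admissible; continuity of the power on `[0, ∞]` then covers convergence and divergence alike. -/
theorem capacity_univ (hT : T.IsSphericallySymmetric) :
    T.capacity p Set.univ = T.levelSum p ^ (1 - p) := by
  refine le_antisymm ?_ (le_iInf₂ fun f hf => levelSum_rpow_le hT hf)
  have hlim : Filter.Tendsto (fun s : Finset {k : ℕ // T.levelCard k ≠ 0} =>
      (∑ k ∈ s, (T.levelCard k : ℝ≥0∞) ^ (1 - p.conjExponent)) ^ (1 - p)) Filter.atTop
      (nhds (T.levelSum p ^ (1 - p))) :=
    (ENNReal.continuous_rpow_const.tendsto _).comp ENNReal.summable.hasSum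
  refine ge_of_tendsto' hlim fun s => ?_
  set S := ∑ k ∈ s, (T.levelCard k : ℝ≥0∞) ^ (1 - p.conjExponent) with hSdef
  -- For an empty set of levels the bound is `0 ^ (1 - p) = ∞`.
  by_cases hS0 : S = 0
  · rw [hS0, ENNReal.zero_rpow_of_neg (by linarith [hp.out])]
    exact le_top
  have hSt : S ≠ ∞ := by
    refine ENNReal.sum_ne_top.2 fun k _ => ?_
    exact ENNReal.rpow_ne_top_of_ne_zero (by exact_mod_cast k.2) (ENNReal.natCast_ne_top _)
  let A : Set ℕ := Subtype.val '' (s : Set {k : ℕ // T.levelCard k ≠ 0})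
  have hA : ∑' k : {k : ℕ // T.levelCard k ≠ 0},
      A.indicator (fun k => (T.levelCard k : ℝ≥0∞) ^ (1 - p.conjExponent)) k = S := by
    rw [tsum_eq_sum (s := s), hSdef]
    · exact Finset.sum_congr rfl fun k hk =>
        Set.indicator_of_mem (Set.mem_image_of_mem Subtype.val (Finset.mem_coe.2 hk)) _
    · intro k hk
      refine Set.indicator_of_notMem ?_ _
      rintro ⟨j, hj, hjk⟩
      exact hk (Subtype.ext hjk ▸ hj)
  obtain ⟨f, hf, -, h⟩ := exists_testFunction_levels (p := p) hT A hA hS0 hSt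
  rw [← h]
  exact capacity_le_of_mem hf

/-! ### Equilibrium functions and equilibrium measures -/

theorem zero_mem_closure_testFunctions {E : Set T.Boundary} (h : T.capacity p E = 0) :
    (0 : T.EdgeLp p) ∈ closure (T.testFunctions p E) := by
  have hp0 : 0 < p := by linarith [hp.out]
  rw [Metric.mem_closure_iff]
  intro ε hε
  have hlt : T.capacity p E < ENNReal.ofReal (ε ^ p) := by
    rw [h, ENNReal.ofReal_pos]
    positivity
  simp only [capacity, iInf_lt_iff] at hlt
  obtain ⟨f, hf, hlt⟩ := hlt
  refine ⟨f, hf, ?_⟩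
  rw [dist_zero_left]
  rw [ENNReal.ofReal_lt_ofReal_iff (by positivity)] at hlt
  exact (Real.rpow_lt_rpow_iff (norm_nonneg f) hε.le hp0).1 hlt

theorem capacity_le_of_mem_closure {E : Set T.Boundary} {f : T.EdgeLp p}
    (hf : f ∈ closure (T.testFunctions p E)) : T.capacity p E ≤ ENNReal.ofReal (‖f‖ ^ p) := by
  have hclosed : IsClosed {f : T.EdgeLp p | T.capacity p E ≤ ENNReal.ofReal (‖f‖ ^ p)} := by
    refine isClosed_le continuous_const (ENNReal.continuous_ofReal.comp ?_)
    exact continuous_norm.rpow_const fun _ => Or.inr (by linarith [hp.out])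
  exact closure_minimal (fun g hg => capacity_le_of_mem hg) hclosed hf

/-- Strict convexity: there is at most one nonnegative equilibrium function. -/
theorem IsEquilibriumFunction.eq {E : Set T.Boundary} {f g : T.EdgeLp p}
    (hf : T.IsEquilibriumFunction p E f) (hg : T.IsEquilibriumFunction p E g)
    (hf0 : ∀ α, 0 ≤ f α) (hg0 : ∀ α, 0 ≤ g α) (α : T.Edge) : f α = g α := by
  have hp0 : 0 < p := by linarith [hp.out]
  by_contra hne
  -- The midpoint remains in the convex closure, so its norm cannot be below the minimum; strict
  -- convexity of t^p at `α` would make it so.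
  set h : T.EdgeLp p := (1 / 2 : ℝ) • f + (1 / 2 : ℝ) • g with hh
  have hmem : h ∈ closure (T.testFunctions p E) :=
    (convex_testFunctions E).closure hf.1 hg.1 (by norm_num) (by norm_num) (by norm_num)
  have hval : ∀ β, h β = (1 / 2 : ℝ) • f β + (1 / 2 : ℝ) • g β := fun β => rfl
  have h1 : ‖f‖ ^ p ≤ ‖h‖ ^ p := by
    have := capacity_le_of_mem_closure hmem
    rwa [← hf.2, ENNReal.ofReal_le_ofReal_iff (by positivity)] at this
  have h2 : ‖f‖ ^ p = ‖g‖ ^ p := by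
    have := hf.2.trans hg.2.symm
    rwa [ENNReal.ofReal_eq_ofReal_iff (by positivity) (by positivity)] at this
  have hlt : ‖h‖ ^ p < (1 / 2 : ℝ) * ‖f‖ ^ p + (1 / 2 : ℝ) * ‖g‖ ^ p := by
    have sf := summable_abs_rpow f
    have sg := summable_abs_rpow g
    rw [norm_rpow_eq_tsum f, norm_rpow_eq_tsum g, norm_rpow_eq_tsum h, ← tsum_mul_left,
      ← tsum_mul_left, ← (sf.mul_left _).tsum_add (sg.mul_left _)]
    have habs : ∀ β, |h β| = h β := fun β => abs_of_nonneg <| by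
      rw [hval]
      exact add_nonneg (mul_nonneg (by norm_num) (hf0 β)) (mul_nonneg (by norm_num) (hg0 β))
    have hsc := strictConvexOn_rpow hp.out
    refine Summable.tsum_lt_tsum (i := α) (fun β => ?_) ?_ (summable_abs_rpow h)
      ((sf.mul_left _).add (sg.mul_left _))
    · rw [habs, hval, abs_of_nonneg (hf0 β), abs_of_nonneg (hg0 β)]
      exact hsc.convexOn.2 (hf0 β) (hg0 β) (by norm_num) (by norm_num) (by norm_num)
    · rw [habs, hval, abs_of_nonneg (hf0 α), abs_of_nonneg (hg0 α)]
      exact hsc.2 (hf0 α) (hg0 α) hne (by norm_num) (by norm_num) (by norm_num)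
  linarith

/-- The common equilibrium function determines the co-potential, as t ↦ t^{p'-1} is injective on t ≥
0, and the co-potential determines the measure. -/
theorem IsEquilibriumMeasure.eq {E : Set T.Boundary} {μ ν : Measure T.Boundary}
    (hμ : T.IsEquilibriumMeasure p E μ) (hν : T.IsEquilibriumMeasure p E ν) : μ = ν := by
  have := hμ.finite
  have := hν.finite
  obtain ⟨f, hf, hfe⟩ := hμ.equilibrium
  obtain ⟨g, hg, hge⟩ := hν.equilibrium
  have hpos : ∀ (ρ : Measure T.Boundary) (α : T.Edge), 0 ≤ T.copotential ρ α :=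
    fun ρ α => measureReal_nonneg
  refine measure_ext_of_copotential fun α => ?_
  have h := hfe.eq hge (fun β => hf β ▸ Real.rpow_nonneg (hpos μ β) _)
    (fun β => hg β ▸ Real.rpow_nonneg (hpos ν β) _) α
  rw [hf, hg] at h
  have hexp : p.conjExponent - 1 ≠ 0 := (Real.HolderConjugate.conjExponent hp.out).symm.sub_one_pos.ne'
  exact (Real.rpow_left_inj (hpos μ α) (hpos ν α) hexp).1 h

theorem exists_isEquilibriumMeasure (hT : T.IsSphericallySymmetric) :
    ∃ μ : Measure T.Boundary, T.IsEquilibriumMeasure p Set.univ μ ∧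
      T.IsSphericallySymmetricMeasure μ := by
  have hpq := Real.HolderConjugate.conjExponent hp.out
  have hexp : 0 < p.conjExponent - 1 := hpq.symm.sub_one_pos
  have hS0 : T.levelSum p ≠ 0 := (lt_of_lt_of_le one_pos one_le_levelSum).ne'
  by_cases hSt : T.levelSum p = ∞
  -- Here the equilibrium function 0 need not be admissible; it is only a limit of test functions of
  -- small norm.
  · have hc : T.capacity p Set.univ = 0 := by
      rw [capacity_univ hT, hSt, ENNReal.top_rpow_of_neg (by linarith [hp.out])]
    refine ⟨0, ⟨inferInstance, by simp, by simp [hc], 0, fun α => ?_, ?_, ?_⟩, fun α β _ => ?_⟩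
    · simp [copotential, Real.zero_rpow hexp.ne']
    · exact zero_mem_closure_testFunctions hc
    · rw [hc, norm_zero, Real.zero_rpow (by linarith [hp.out]), ENNReal.ofReal_zero]
    · simp [copotential]
  · obtain ⟨f, hf, hfα, hfn⟩ := exists_testFunction_levels (p := p) hT Set.univ
      (S := T.levelSum p) (by simp only [Set.indicator_univ]; rfl) hS0 hSt
    have hcop : ∀ α, T.copotential (T.levelSum p ^ (1 - p) • T.uniformBoundary) α =
        (T.levelSum p ^ (1 - p) * (T.levelCard (T.level α) : ℝ≥0∞)⁻¹).toReal := fun α => by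
      rw [copotential, Measure.real, Measure.smul_apply, smul_eq_mul,
        uniformBoundary_tentBoundary hT]
    have hfin : T.levelSum p ^ (1 - p) ≠ ∞ := ENNReal.rpow_ne_top_of_ne_zero hS0 hSt
    have huniv : (T.levelSum p ^ (1 - p) • T.uniformBoundary) Set.univ = T.levelSum p ^ (1 - p) := by
      rw [Measure.smul_apply, uniformBoundary_univ hT, smul_eq_mul, mul_one]
    refine ⟨T.levelSum p ^ (1 - p) • T.uniformBoundary,
      ⟨⟨by rw [huniv]; exact hfin.lt_top⟩, by simp, ?_, f, fun α => ?_, subset_closure hf, ?_⟩,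
      fun α β h => by rw [hcop, hcop, h]⟩
    · rw [closure_univ, huniv, capacity_univ hT]
    -- Raising S^{1-p}/N to the power p'-1 gives S⁻¹ N^{1-p'}, the optimal radial function.
    · rw [hfα, hcop, ENNReal.toReal_rpow, ENNReal.mul_rpow_of_nonneg _ _ hexp.le,
        ← ENNReal.rpow_mul, Set.indicator_univ, ENNReal.inv_rpow, ← ENNReal.rpow_neg,
        show (1 - p) * (p.conjExponent - 1) = -1 by linarith [hpq.mul_eq_add],
        ENNReal.rpow_neg_one, neg_sub]
    · rw [hfn, capacity_univ hT]

theorem capacity_of_isHomogeneous {n : ℕ} (hn : 1 ≤ n) (hT : T.IsHomogeneous n) :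
    T.capacity p Set.univ = ENNReal.ofReal ((1 - (n : ℝ) ^ (1 - p.conjExponent)) ^ (p - 1)) := by
  have hexp : 0 < p.conjExponent - 1 := (Real.HolderConjugate.conjExponent hp.out).symm.sub_one_pos
  have hr : (n : ℝ) ^ (1 - p.conjExponent) ≤ 1 :=
    Real.rpow_le_one_of_one_le_of_nonpos (by exact_mod_cast hn) (by linarith)
  have hn0 : (0 : ℝ) < n := by exact_mod_cast hn
  rw [capacity_univ fun α β _ => (hT α).trans (hT β).symm, levelSum_of_isHomogeneous hn hT,
    ENNReal.inv_rpow, ← ENNReal.rpow_neg, neg_sub,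
    ← ENNReal.ofReal_rpow_of_nonneg (by linarith) (by linarith [hp.out]),
    ENNReal.ofReal_sub _ (by positivity), ENNReal.ofReal_one, ← ENNReal.ofReal_rpow_of_pos hn0,
    ENNReal.ofReal_natCast]

end Capacity

end Capacities

end RootEdgeTree

end

theorem mainTheorem11 {V : Type*} (T : RootEdgeTree V) (p : ℝ) [Fact (1 < p)] :
    (T.IsSphericallySymmetric →
      (∃! μ : MeasureTheory.Measure T.Boundary, T.IsEquilibriumMeasure p Set.univ μ) ∧
      (∀ μ : MeasureTheory.Measure T.Boundary, T.IsEquilibriumMeasure p Set.univ μ →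
        T.IsSphericallySymmetricMeasure μ) ∧
      T.capacity p Set.univ =
        (∑' k : {k : ℕ // T.levelCard k ≠ 0},
          (T.levelCard k : ℝ≥0∞) ^ (1 - p.conjExponent)) ^ (1 - p)) ∧
    (∀ n : ℕ, 1 ≤ n → T.IsHomogeneous n →
      T.capacity p Set.univ =
        ENNReal.ofReal ((1 - (n : ℝ) ^ (1 - p.conjExponent)) ^ (p - 1))) := by
  refine ⟨fun hT => ?_, fun n hn hT => RootEdgeTree.capacity_of_isHomogeneous hn hT⟩
  obtain ⟨μ, hμ, hsymm⟩ := RootEdgeTree.exists_isEquilibriumMeasure (p := p) hT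
  exact ⟨⟨μ, hμ, fun ν hν => hν.eq hμ⟩, fun ν hν => hν.eq hμ ▸ hsymm,
    RootEdgeTree.capacity_univ hT⟩
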